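/- A deterministic iterated graph system consists of a finite set of colours $\{1,\dots,\lambda\}$, an initial graph $\Xi^0$ and, for each colour $i$, a rule graph $R_i$. Each of these is a finite, weakly connected directed graph without self-loops or multiple arcs, whose arcs are coloured with $1,\dots,\lambda$, and in which two distinct nodes $A$ and $B$ are marked; moreover the distance between $A$ and $B$ in each $R_i$ is at least $2$. The graph $\Xi^{n+1}$ is obtained from $\Xi^n$ by replacing every arc $e$, of colour $i$ say, by a new copy of $R_i$, whose node $A$ is identified with the source of $e$ and whose node $B$ is identified with the target of $e$; the marked nodes $A,B$ of $\Xi^{n+1}$ are those of $\Xi^n$. Paths and distances ignore the directions of arcs, paths visit no node twice, and the length $|P|$ of a path $P$ is its number of arcs. For a graph or path $H$ let $\chi(H)$ be the vector whose $j$-th entry is the number of arcs of $H$ of colour $j$. Let $\mathbf M$ be the $\lambda\times\lambda$ matrix with $i$-th row $\chi(R_i)$, let $\mathcal D$ be the set of all $\lambda\times\lambda$ matrices with rows $\chi(P_1),\dots,\chi(P_\lambda)$, where $P_i$ is a path from $A$ to $B$ in $R_i$ for each $i$, and let $\rho_{\min}(\mathcal D)=\min\{\rho(\mathbf D):\mathbf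 D\in\mathcal D\}$, where $\rho$ is the spectral radius. The system is called primitive if $\mathbf M$ and all matrices in $\mathcal D$ are primitive (nonnegative, with some positive power entrywise positive). Theorem. For every primitive deterministic iterated graph system, the minimum $\rho_{\min}(\mathcal D)$ exists, each $\Xi^n$ contains a shortest path $\Gamma^n$ between $A$ and $B$, and $|\Gamma^n|\asymp\rho_{\min}(\mathcal D)^n$ as $n\to\infty$, that is, there is a constant $c>0$ with \[ \lim_{n\to\infty}\frac{|\Gamma^n|}{\rho_{\min}(\mathcal D)^n}=c . \] -/

import Mathlib

open Filter Topology

universe u v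

/-- A directed graph with node type `V` and arc type `E`, whose arcs carry colours in `κ`, together
with two marked nodes `A` and `B`. -/
structure MarkedGraph (κ : Type v) where
  V : Type u
  E : Type u
  src : E → V
  tgt : E → V
  col : E → κ
  A : V
  B : V

namespace MarkedGraph

variable {κ : Type v}

/-- The arc `e`, with its direction ignored, joins the nodes `x` and `y`. -/
def Joins (G : MarkedGraph.{u, v} κ) (e : G.E) (x y : G.V) : Prop :=
  (G.src e = x ∧ G.tgt e = y) ∨ (G.src e = y ∧ G.tgt e = x)

/-- Walks in the underlying undirected graph; a walk records the arcs that it uses. -/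
inductive Walk (G : MarkedGraph.{u, v} κ) : G.V → G.V → Type u
  | nil (x : G.V) : Walk G x x
  | cons {x y z : G.V} (e : G.E) (h : G.Joins e x y) (p : Walk G y z) : Walk G x z

namespace Walk

variable {G : MarkedGraph.{u, v} κ}

/-- The list of nodes visited by a walk. -/
def support : {x y : G.V} → G.Walk x y → List G.V
  | x, _, nil _ => [x]
  | x, _, cons _ _ p => x :: p.support

/-- The list of arcs used by a walk. -/
def arcs : {x y : G.V} → G.Walk x y → List G.E
  | _, _, nil _ => []
  | _, _, cons e _ p => e :: p.arcs

/-- The number of arcs of a walk. -/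
def length {x y : G.V} (p : G.Walk x y) : ℕ := p.arcs.length

/-- A path is a walk that visits no node twice. -/
def IsPath {x y : G.V} (p : G.Walk x y) : Prop := p.support.Nodup

/-- A shortest path between two nodes. -/
def IsShortestPath {x y : G.V} (p : G.Walk x y) : Prop :=
  p.IsPath ∧ ∀ q : G.Walk x y, q.IsPath → p.length ≤ q.length

/-- The colour vector `χ(p)`: its `j`-th entry is the number of `j`-coloured arcs of `p`. -/
def chi [DecidableEq κ] {x y : G.V} (p : G.Walk x y) (j : κ) : ℕ := (p.arcs.map G.col).count j

end Walk

/-- Finite, weakly connected, without self-loops, without multiple arcs, and the two marked nodes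
are different. -/
structure IsAdmissible (G : MarkedGraph.{u, v} κ) : Prop where
  finite_V : Finite G.V
  finite_E : Finite G.E
  loopless : ∀ e, G.src e ≠ G.tgt e
  simple : ∀ e f, G.src e = G.src f → G.tgt e = G.tgt f → e = f
  connected : ∀ x y, Nonempty (G.Walk x y)
  A_ne_B : G.A ≠ G.B

/-- The colour vector `χ(G)`: its `j`-th entry is the number of `j`-coloured arcs of `G`. -/
noncomputable def chi (G : MarkedGraph.{u, v} κ) (j : κ) : ℕ := Nat.card {e : G.E // G.col e = j}

/-- The nodes of `G` other than `A` and `B`. -/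
abbrev Inner (G : MarkedGraph.{u, v} κ) : Type u := {x : G.V // x ≠ G.A ∧ x ≠ G.B}

variable (R : κ → MarkedGraph.{u, v} κ) (G : MarkedGraph.{u, v} κ)

/-- The nodes after one substitution: the old ones, and for each arc `e` the inner nodes of a fresh
copy of the rule graph of the colour of `e`. -/
abbrev SubstV : Type u := G.V ⊕ (Σ e : G.E, (R (G.col e)).Inner)

open Classical in
/-- The position, in the substituted graph, of a node of the rule graph copy that replaces `e`: the
node `A` is identified with the source of `e` and the node `B` with its target. -/
noncomputable def place (e : G.E) (x : (R (G.col e)).V) : SubstV R G :=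
  if hA : x = (R (G.col e)).A then Sum.inl (G.src e)
  else if hB : x = (R (G.col e)).B then Sum.inl (G.tgt e)
  else Sum.inr ⟨e, ⟨x, hA, hB⟩⟩

/-- One substitution: every `i`-coloured arc of `G`, for every colour `i`, is replaced by a copy of
`R i`; the marked nodes stay the same. -/
noncomputable def subst : MarkedGraph.{u, v} κ where
  V := SubstV R G
  E := Σ e : G.E, (R (G.col e)).E
  src := fun a => place R G a.1 ((R (G.col a.1)).src a.2)
  tgt := fun a => place R G a.1 ((R (G.col a.1)).tgt a.2)
  col := fun a => (R (G.col a.1)).col a.2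
  A := Sum.inl G.A
  B := Sum.inl G.B

end MarkedGraph

/-- A deterministic iterated graph system with colour set `κ`: an initial graph and one rule graph
for each colour. In every rule graph the nodes `A` and `B` have distance at least two. -/
structure IteratedGraphSystem (κ : Type v) where
  init : MarkedGraph.{u, v} κ
  rule : κ → MarkedGraph.{u, v} κ
  init_admissible : init.IsAdmissible
  rule_admissible : ∀ i, (rule i).IsAdmissible
  two_le_dist : ∀ i, ∀ p : (rule i).Walk (rule i).A (rule i).B, 2 ≤ p.length

namespace IteratedGraphSystem

variable {κ : Type v} (S : IteratedGraphSystem.{u, v} κ)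

/-- The substitution graphs `Ξ⁰, Ξ¹, Ξ², …`. -/
noncomputable def Xi : ℕ → MarkedGraph.{u, v} κ
  | 0 => S.init
  | n + 1 => MarkedGraph.subst S.rule (Xi n)

/-- The matrix `M` whose `i`-th row is the colour vector of the `i`-th rule graph. -/
noncomputable def arcMatrix : Matrix κ κ ℝ := Matrix.of fun i j => ((S.rule i).chi j : ℝ)

/-- The set `𝒟` of path matrices: for a choice of an `A`–`B` path `P i` in each rule graph, the
matrix whose `i`-th row is the colour vector of `P i`. -/
def pathMatrices [DecidableEq κ] : Set (Matrix κ κ ℝ) :=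
  {D | ∃ P : ∀ i, (S.rule i).Walk (S.rule i).A (S.rule i).B,
    (∀ i, (P i).IsPath) ∧ D = Matrix.of fun i j => ((P i).chi j : ℝ)}

/-- The system is primitive: `M` and all path matrices are primitive. -/
def IsPrimitive [Fintype κ] [DecidableEq κ] : Prop :=
  S.arcMatrix.IsPrimitive ∧ ∀ D ∈ S.pathMatrices, D.IsPrimitive

/-- The spectral radius of a real matrix: the largest modulus of its complex eigenvalues. -/
noncomputable def specRad [Fintype κ] [DecidableEq κ] (D : Matrix κ κ ℝ) : ℝ :=
  (spectralRadius ℂ (D.map Complex.ofReal)).toReal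

/-- The smallest spectral radius of a path matrix. -/
noncomputable def rhoMin [Fintype κ] [DecidableEq κ] : ℝ := sInf (specRad '' S.pathMatrices)

end IteratedGraphSystem

namespace MarkedGraph

variable {κ : Type v}

theorem Joins.symm {G : MarkedGraph.{u, v} κ} {e : G.E} {x y : G.V} (h : G.Joins e x y) :
    G.Joins e y x := Or.symm h

namespace Walk

variable {G : MarkedGraph.{u, v} κ}

/-- Concatenation of walks. -/
def append : {x y z : G.V} → G.Walk x y → G.Walk y z → G.Walk x z
  | _, _, _, nil _, q => q
  | _, _, _, cons e h p, q => cons e h (p.append q)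

/-- The walk traversed backwards. -/
def reverse : {x y : G.V} → G.Walk x y → G.Walk y x
  | _, _, nil x => nil x
  | _, _, cons e h p => p.reverse.append (cons e h.symm (nil _))

/-- The total weight of the arcs of a walk, where an arc has the weight of its colour. -/
def weight (w : κ → ℕ) {x y : G.V} (p : G.Walk x y) : ℕ :=
  (p.arcs.map fun e => w (G.col e)).sum

variable (w : κ → ℕ) {x y z : G.V}

@[simp] theorem weight_nil : (nil x : G.Walk x x).weight w = 0 := rfl

@[simp] theorem weight_cons (e : G.E) (h : G.Joins e x y) (p : G.Walk y z) :
    (cons e h p).weight w = w (G.col e) + p.weight w := by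
  simp [weight, arcs]

@[simp] theorem weight_append (p : G.Walk x y) (q : G.Walk y z) :
    (p.append q).weight w = p.weight w + q.weight w := by
  induction p with
  | nil => simp [append]
  | cons e h p ih => simp [append, ih, add_assoc]

@[simp] theorem weight_reverse (p : G.Walk x y) : p.reverse.weight w = p.weight w := by
  induction p with
  | nil => simp [reverse]
  | cons e h p ih => simp [reverse, ih, add_comm]

theorem weight_one (p : G.Walk x y) : p.weight (fun _ => 1) = p.length := by
  simp [weight, length]

theorem weight_eq_sum_chi [Fintype κ] [DecidableEq κ] (p : G.Walk x y) :
    p.weight w = ∑ j, p.chi j * w j := by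
  induction p with
  | nil => simp [chi, arcs]
  | cons e h p ih =>
    simp [chi, arcs, ih, List.count_cons, add_mul, Finset.sum_add_distrib, add_comm]

theorem length_support (p : G.Walk x y) : p.support.length = p.length + 1 := by
  induction p with
  | nil => rfl
  | cons e h p ih => simpa [support, arcs, length] using ih

theorem chi_le_length [DecidableEq κ] (p : G.Walk x y) (j : κ) : p.chi j ≤ p.length := by
  simpa [chi, length] using (List.count_le_length (l := p.arcs.map G.col) (a := j))

/-- The part of a walk from a visited node on. -/
theorem exists_suffix (p : G.Walk x y) (hz : z ∈ p.support) :
    ∃ q : G.Walk z y, q.support.Sublist p.support ∧ q.arcs.Sublist p.arcs := by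
  induction p with
  | nil a =>
    obtain rfl : z = a := by simpa [support] using hz
    exact ⟨nil z, List.Sublist.refl _, List.Sublist.refl _⟩
  | cons e h p ih =>
    rename_i a b c
    by_cases hza : z = a
    · subst hza
      exact ⟨cons e h p, List.Sublist.refl _, List.Sublist.refl _⟩
    · obtain ⟨q, h1, h2⟩ := ih (by simpa [support, hza] using hz)
      exact ⟨q, h1.cons _, h2.cons _⟩

/-- Every walk can be shortened to a path. -/
theorem exists_isPath (p : G.Walk x y) :
    ∃ q : G.Walk x y, q.IsPath ∧ q.arcs.Sublist p.arcs := by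
  induction p with
  | nil a => exact ⟨nil a, by simp [IsPath, support], List.Sublist.refl _⟩
  | cons e h p ih =>
    rename_i a b c
    obtain ⟨q, hq, hs⟩ := ih
    by_cases ha : a ∈ q.support
    · obtain ⟨r, h1, h2⟩ := q.exists_suffix ha
      exact ⟨r, hq.sublist h1, (h2.trans hs).cons _⟩
    · exact ⟨cons e h q, List.nodup_cons.2 ⟨ha, hq⟩, hs.cons_cons _⟩

theorem weight_le_of_sublist {p q : G.Walk x y} (h : q.arcs.Sublist p.arcs) :
    q.weight w ≤ p.weight w :=
  (h.map _).sum_le_sum (by simp)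

/-- A potential that grows along each arc by at most its weight grows along a walk by at most the
weight of the walk. -/
theorem le_add_weight {φ : G.V → ℕ}
    (hφ : ∀ e a b, G.Joins e a b → φ b ≤ φ a + w (G.col e)) (p : G.Walk x y) :
    φ y ≤ φ x + p.weight w := by
  induction p with
  | nil => simp
  | cons e h p ih =>
    have := hφ _ _ _ h
    rw [weight_cons]
    omega

end Walk

/-- Finitely many colour vectors belong to paths between two given nodes. -/
theorem finite_setOf_chi [Finite κ] [DecidableEq κ] (G : MarkedGraph.{u, v} κ) [Finite G.V]
    (x y : G.V) : {c : κ → ℕ | ∃ p : G.Walk x y, p.IsPath ∧ c = p.chi}.Finite := by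
  have := Fintype.ofFinite κ
  have := Fintype.ofFinite G.V
  refine (Set.finite_Iic (fun _ : κ => Fintype.card G.V)).subset ?_
  rintro _ ⟨p, hp, rfl⟩ j
  have h1 := p.length_support
  have h2 := p.chi_le_length j
  have h3 := List.Nodup.length_le_card hp
  show p.chi j ≤ Fintype.card G.V
  omega

section wdist

variable (G : MarkedGraph.{u, v} κ) (w : κ → ℕ)

/-- The weighted distance of two nodes, where an arc has the weight of its colour. -/
noncomputable def wdist (x y : G.V) : ℕ := sInf {n | ∃ p : G.Walk x y, p.weight w = n}

variable {G} {w} {x y z : G.V}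

theorem wdist_le (p : G.Walk x y) : G.wdist w x y ≤ p.weight w := Nat.sInf_le ⟨p, rfl⟩

@[simp] theorem wdist_self : G.wdist w x x = 0 :=
  Nat.le_zero.1 (wdist_le (Walk.nil x))

theorem exists_isPath_weight_eq_wdist (h : Nonempty (G.Walk x y)) :
    ∃ p : G.Walk x y, p.IsPath ∧ p.weight w = G.wdist w x y := by
  obtain ⟨p, hp⟩ := Nat.sInf_mem (s := {n | ∃ p : G.Walk x y, p.weight w = n})
    (h.elim fun p => ⟨_, p, rfl⟩)
  obtain ⟨q, hq, hs⟩ := p.exists_isPath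
  exact ⟨q, hq, le_antisymm ((Walk.weight_le_of_sublist w hs).trans hp.le) (wdist_le q)⟩

theorem wdist_le_add_right (h : Nonempty (G.Walk x y)) {e : G.E} (he : G.Joins e y z) :
    G.wdist w x z ≤ G.wdist w x y + w (G.col e) := by
  obtain ⟨p, -, hp⟩ := exists_isPath_weight_eq_wdist (w := w) h
  simpa [hp] using wdist_le (w := w) (p.append (.cons e he (.nil z)))

theorem wdist_le_add_left (h : Nonempty (G.Walk y z)) {e : G.E} (he : G.Joins e x y) :
    G.wdist w x z ≤ G.wdist w y z + w (G.col e) := by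
  obtain ⟨p, -, hp⟩ := exists_isPath_weight_eq_wdist (w := w) h
  simpa [hp, add_comm] using wdist_le (w := w) (.cons e he p)

theorem wdist_le_of_forall_joins (h : Nonempty (G.Walk x y)) (φ : G.V → ℕ)
    (hφ : ∀ e a b, G.Joins e a b → φ b ≤ φ a + w (G.col e)) : φ y ≤ φ x + G.wdist w x y := by
  obtain ⟨p, -, hp⟩ := exists_isPath_weight_eq_wdist (w := w) h
  exact hp ▸ p.le_add_weight w hφ

end wdist

section subst

variable (R : κ → MarkedGraph.{u, v} κ) (G : MarkedGraph.{u, v} κ) (w : κ → ℕ)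

variable {R} in
/-- A node of `G`, as a node of the substituted graph. -/
def oldNode (x : G.V) : (subst R G).V := Sum.inl x

variable {R} in
/-- A node of the copy of the rule graph that replaces `e`, as a node of the substituted graph. -/
noncomputable def copyNode (e : G.E) (x : (R (G.col e)).V) : (subst R G).V := place R G e x

variable {R} in
/-- An arc of the copy of the rule graph that replaces `e`, as an arc of the substituted graph. -/
def copyArc (e : G.E) (f : (R (G.col e)).E) : (subst R G).E := ⟨e, f⟩

theorem copyNode_A (e : G.E) : copyNode G e (R (G.col e)).A = oldNode G (G.src e) :=
  dif_pos rfl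

variable {R}

theorem copyNode_B (hR : ∀ i, (R i).IsAdmissible) (e : G.E) :
    copyNode G e (R (G.col e)).B = oldNode G (G.tgt e) :=
  (dif_neg (hR _).A_ne_B.symm).trans (dif_pos rfl)

theorem copyNode_inner (e : G.E) (x : (R (G.col e)).Inner) :
    copyNode G e x = (Sum.inr ⟨e, x⟩ : SubstV R G) :=
  (dif_neg x.2.1).trans (dif_neg x.2.2)

/-- A walk in a rule graph gives a walk in the copy that replaces an arc. -/
theorem exists_walk_copyNode (e : G.E) {a b : (R (G.col e)).V} (p : (R (G.col e)).Walk a b) :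
    ∃ q : (subst R G).Walk (copyNode G e a) (copyNode G e b), q.weight w = p.weight w := by
  induction p with
  | nil x => exact ⟨.nil _, rfl⟩
  | cons f h p ih =>
    obtain ⟨q, hq⟩ := ih
    rename_i x y z
    have hj : (subst R G).Joins (copyArc G e f) (copyNode G e x) (copyNode G e y) := by
      rcases h with ⟨rfl, rfl⟩ | ⟨rfl, rfl⟩
      · exact Or.inl ⟨rfl, rfl⟩
      · exact Or.inr ⟨rfl, rfl⟩
    refine ⟨.cons _ hj q, ?_⟩
    rw [Walk.weight_cons, Walk.weight_cons, hq]
    rfl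

variable (R) in
/-- The weight of a colour after one substitution: the weighted distance of the marked nodes in the
rule graph. -/
noncomputable def ruleWeight (i : κ) : ℕ := (R i).wdist w (R i).A (R i).B

/-- The source and the target of an arc are joined in its copy of the rule graph. -/
theorem exists_walk_src_tgt (hR : ∀ i, (R i).IsAdmissible) (e : G.E) :
    ∃ q : (subst R G).Walk (oldNode G (G.src e)) (oldNode G (G.tgt e)),
      q.weight w = ruleWeight R w (G.col e) := by
  obtain ⟨r, -, hr⟩ := exists_isPath_weight_eq_wdist (w := w)
    ((hR (G.col e)).connected (R (G.col e)).A (R (G.col e)).B)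
  have h := exists_walk_copyNode G w e r
  rw [copyNode_A, copyNode_B G hR, hr] at h
  exact h

/-- A walk in `G` can be replaced by a walk in the substituted graph of the corresponding weight. -/
theorem exists_walk_subst (hR : ∀ i, (R i).IsAdmissible) {x y : G.V} (p : G.Walk x y) :
    ∃ q : (subst R G).Walk (oldNode G x) (oldNode G y), q.weight w = p.weight (ruleWeight R w) := by
  induction p with
  | nil x => exact ⟨.nil _, rfl⟩
  | cons e h p ih =>
    obtain ⟨q, hq⟩ := ih
    rename_i x y z
    have hs : ∃ s : (subst R G).Walk (oldNode G x) (oldNode G y),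
        s.weight w = ruleWeight R w (G.col e) := by
      obtain ⟨s, hs⟩ := exists_walk_src_tgt G w hR e
      rcases h with ⟨rfl, rfl⟩ | ⟨rfl, rfl⟩
      · exact ⟨s, hs⟩
      · exact ⟨s.reverse, by rw [Walk.weight_reverse, hs]⟩
    obtain ⟨s, hs⟩ := hs
    exact ⟨s.append q, by rw [Walk.weight_append, Walk.weight_cons, hs, hq]⟩

variable {G}

theorem subst_connected (hR : ∀ i, (R i).IsAdmissible) (hG : ∀ x y, Nonempty (G.Walk x y))
    (x y : (subst R G).V) : Nonempty ((subst R G).Walk x y) := by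
  have key : ∀ z : (subst R G).V, ∃ a : G.V, Nonempty ((subst R G).Walk (oldNode G a) z) := by
    rintro (a | ⟨e, z⟩)
    · exact ⟨a, ⟨.nil _⟩⟩
    · obtain ⟨r⟩ := (hR (G.col e)).connected (R (G.col e)).A z
      have h := exists_walk_copyNode G 0 e r
      rw [copyNode_A, copyNode_inner] at h
      exact ⟨_, ⟨h.choose⟩⟩
  obtain ⟨a, ⟨p⟩⟩ := key x
  obtain ⟨b, ⟨q⟩⟩ := key y
  obtain ⟨r⟩ := hG a b
  exact ⟨p.reverse.append ((exists_walk_subst G 0 hR r).choose.append q)⟩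

/-- An old potential, extended to the inner nodes of the copies of the rule graphs. -/
noncomputable def extendPotential (d : G.V → ℕ) (e : G.E) (z : (R (G.col e)).V) : ℕ :=
  min (d (G.src e) + (R (G.col e)).wdist w (R (G.col e)).A z)
    (d (G.tgt e) + (R (G.col e)).wdist w z (R (G.col e)).B)

theorem extendPotential_A {d : G.V → ℕ} {e : G.E}
    (h : d (G.src e) ≤ d (G.tgt e) + ruleWeight R w (G.col e)) :
    extendPotential (R := R) w d e (R (G.col e)).A = d (G.src e) := by
  simpa [extendPotential, ruleWeight] using h

theorem extendPotential_B {d : G.V → ℕ} {e : G.E}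
    (h : d (G.tgt e) ≤ d (G.src e) + ruleWeight R w (G.col e)) :
    extendPotential (R := R) w d e (R (G.col e)).B = d (G.tgt e) := by
  simpa [extendPotential, ruleWeight] using h

theorem extendPotential_le (hR : ∀ i, (R i).IsAdmissible) (d : G.V → ℕ) {e : G.E}
    {f : (R (G.col e)).E} {a b : (R (G.col e)).V} (h : (R (G.col e)).Joins f a b) :
    extendPotential w d e b ≤ extendPotential w d e a + w ((R (G.col e)).col f) := by
  have h1 := wdist_le_add_right (w := w) ((hR (G.col e)).connected (R (G.col e)).A a) h
  have h2 := wdist_le_add_left (w := w) ((hR (G.col e)).connected a (R (G.col e)).B) h.symm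
  unfold extendPotential
  omega

/-- Distances between old nodes in the substituted graph are the distances in the old graph for
the substituted weights. -/
theorem wdist_subst (hR : ∀ i, (R i).IsAdmissible) (hG : ∀ x y, Nonempty (G.Walk x y))
    (x y : G.V) :
    (subst R G).wdist w (oldNode G x) (oldNode G y) = G.wdist (ruleWeight R w) x y := by
  apply le_antisymm
  · obtain ⟨p, -, hp⟩ := exists_isPath_weight_eq_wdist (w := ruleWeight R w) (hG x y)
    obtain ⟨q, hq⟩ := exists_walk_subst G w hR p
    exact hp ▸ hq ▸ wdist_le q
  · set d : G.V → ℕ := fun z => G.wdist (ruleWeight R w) x z with hd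
    have hsrc : ∀ e, d (G.src e) ≤ d (G.tgt e) + ruleWeight R w (G.col e) := fun e =>
      wdist_le_add_right (hG _ _) (Or.inr ⟨rfl, rfl⟩)
    have htgt : ∀ e, d (G.tgt e) ≤ d (G.src e) + ruleWeight R w (G.col e) := fun e =>
      wdist_le_add_right (hG _ _) (Or.inl ⟨rfl, rfl⟩)
    let φ : (subst R G).V → ℕ := Sum.elim d fun z => extendPotential (R := R) w d z.1 z.2
    have hφ : ∀ e z, φ (copyNode G e z) = extendPotential w d e z := by
      intro e z
      by_cases hA : z = (R (G.col e)).A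
      · subst hA
        rw [copyNode_A, extendPotential_A w (hsrc e)]
        rfl
      by_cases hB : z = (R (G.col e)).B
      · subst hB
        rw [copyNode_B G hR, extendPotential_B w (htgt e)]
        rfl
      exact congrArg φ (copyNode_inner G e ⟨z, hA, hB⟩)
    have h := wdist_le_of_forall_joins (w := w)
      (subst_connected hR hG (oldNode G x) (oldNode G y)) φ (by
        rintro ⟨e, f⟩ a b (⟨rfl, rfl⟩ | ⟨rfl, rfl⟩)
        · change φ (copyNode G e _) ≤ φ (copyNode G e _) + _
          rw [hφ, hφ]
          exact extendPotential_le w hR d (Or.inl ⟨rfl, rfl⟩)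
        · change φ (copyNode G e _) ≤ φ (copyNode G e _) + _
          rw [hφ, hφ]
          exact extendPotential_le w hR d (Or.inr ⟨rfl, rfl⟩))
    change d y ≤ d x + _ at h
    simpa [hd] using h

end subst

end MarkedGraph

namespace IteratedGraphSystem

open MarkedGraph

variable {κ : Type v} (S : IteratedGraphSystem.{u, v} κ)

theorem Xi_connected (n : ℕ) (x y : (S.Xi n).V) : Nonempty ((S.Xi n).Walk x y) := by
  induction n with
  | zero => exact S.init_admissible.connected x y
  | succ n ih => exact subst_connected S.rule_admissible ih x y

/-- The distance of the marked nodes in `Ξⁿ` is a weighted distance in `Ξ⁰`. -/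
theorem wdist_Xi (n : ℕ) (w : κ → ℕ) :
    (S.Xi n).wdist w (S.Xi n).A (S.Xi n).B =
      S.init.wdist ((ruleWeight S.rule)^[n] w) S.init.A S.init.B := by
  induction n generalizing w with
  | zero => rfl
  | succ n ih =>
    rw [Function.iterate_succ_apply, ← ih]
    exact wdist_subst w S.rule_admissible (S.Xi_connected n) _ _

theorem exists_isShortestPath (n : ℕ) :
    ∃ Γ : (S.Xi n).Walk (S.Xi n).A (S.Xi n).B, Γ.IsShortestPath := by
  obtain ⟨p, hp, h⟩ := exists_isPath_weight_eq_wdist (w := fun _ => 1)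
    (S.Xi_connected n (S.Xi n).A (S.Xi n).B)
  refine ⟨p, hp, fun q _ => ?_⟩
  rw [← p.weight_one, ← q.weight_one, h]
  exact wdist_le q

theorem length_eq_wdist {n : ℕ} {Γ : (S.Xi n).Walk (S.Xi n).A (S.Xi n).B}
    (h : Γ.IsShortestPath) :
    Γ.length = S.init.wdist ((ruleWeight S.rule)^[n] fun _ => 1) S.init.A S.init.B := by
  obtain ⟨p, hp, hw⟩ := exists_isPath_weight_eq_wdist (w := fun _ => 1)
    (S.Xi_connected n (S.Xi n).A (S.Xi n).B)
  rw [← S.wdist_Xi, ← Γ.weight_one]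
  refine le_antisymm ?_ (wdist_le Γ)
  rw [← hw, Γ.weight_one, p.weight_one]
  exact h.2 p hp

end IteratedGraphSystem

namespace IteratedGraphSystem

open Matrix

variable {κ : Type v} [Fintype κ]

theorem mulVec_le_mulVec {D : Matrix κ κ ℝ} (hD : ∀ i j, 0 ≤ D i j) {x y : κ → ℝ} (h : x ≤ y) :
    D *ᵥ x ≤ D *ᵥ y := fun i =>
  Finset.sum_le_sum fun j _ => mul_le_mul_of_nonneg_left (h j) (hD i j)

theorem mulVec_pos {D : Matrix κ κ ℝ} (hD : ∀ i j, 0 < D i j) {x : κ → ℝ} (hx : 0 ≤ x)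
    (hx0 : x ≠ 0) (i : κ) : 0 < (D *ᵥ x) i := by
  obtain ⟨k, hk⟩ := Function.ne_iff.1 hx0
  exact Finset.sum_pos' (fun j _ => mul_nonneg (hD i j).le (hx j))
    ⟨k, Finset.mem_univ k, mul_pos (hD i k) ((hx k).lt_of_ne' hk)⟩

/-- A vector that is strictly positive at each index can absorb a small multiple of another one. -/
theorem exists_pos_smul_le [Nonempty κ] {a b : κ → ℝ} (ha : ∀ i, 0 < a i) (hb : ∀ i, 0 < b i) :
    ∃ ε > 0, ∀ i, ε * b i ≤ a i := by
  obtain ⟨k, hk⟩ := Finite.exists_min fun i => a i / b i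
  exact ⟨a k / b k, div_pos (ha k) (hb k), fun i => (le_div_iff₀ (hb i)).1 (hk i)⟩

theorem sum_mulVec_le {D : Matrix κ κ ℝ} (hD : ∀ i j, 0 ≤ D i j) {x : κ → ℝ}
    (hx : x ∈ stdSimplex ℝ κ) : ∑ i, (D *ᵥ x) i ≤ ∑ i, ∑ j, D i j := by
  refine Finset.sum_le_sum fun i _ => Finset.sum_le_sum fun j _ => ?_
  refine mul_le_of_le_one_right (hD i j) ?_
  exact hx.2 ▸ Finset.single_le_sum (fun k _ => hx.1 k) (Finset.mem_univ j)

variable [DecidableEq κ]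

/-- The Collatz–Wielandt bound. -/
theorem spectralRadius_le [Nonempty κ] {D : Matrix κ κ ℝ} (hD : ∀ i j, 0 ≤ D i j) {w : κ → ℝ}
    (hw : ∀ i, 0 < w i) {r : ℝ} (h : D *ᵥ w ≤ r • w) :
    spectralRadius ℂ (D.map Complex.ofReal) ≤ ENNReal.ofReal r := by
  refine iSup₂_le fun μ hμ => ?_
  rw [← Matrix.spectrum_toLin', ← Module.End.hasEigenvalue_iff_mem_spectrum] at hμ
  obtain ⟨z, hz⟩ := hμ.exists_hasEigenvector
  have hz1 : (D.map Complex.ofReal) *ᵥ z = μ • z := by simpa using hz.apply_eq_smul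
  obtain ⟨k, hk⟩ := Finite.exists_max fun i => ‖z i‖ / w i
  set t := ‖z k‖ / w k with ht
  have hzt : ∀ i, ‖z i‖ ≤ t * w i := fun i => (div_le_iff₀ (hw i)).1 (hk i)
  have hzk : ‖z k‖ = t * w k := by rw [ht, div_mul_cancel₀ _ (hw k).ne']
  have ht0 : 0 < t := by
    obtain ⟨i, hi⟩ := Function.ne_iff.1 hz.2
    exact (div_pos (norm_pos_iff.2 hi) (hw i)).trans_le (hk i)
  have h1 : ‖μ‖ * ‖z k‖ ≤ r * ‖z k‖ := calc
    ‖μ‖ * ‖z k‖ = ‖∑ j, (D k j : ℂ) * z j‖ := by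
      rw [← norm_mul]
      exact congrArg norm (congrFun hz1 k).symm
    _ ≤ ∑ j, D k j * (t * w j) := by
      refine (norm_sum_le _ _).trans (Finset.sum_le_sum fun j _ => ?_)
      rw [norm_mul, Complex.norm_real, Real.norm_of_nonneg (hD k j)]
      exact mul_le_mul_of_nonneg_left (hzt j) (hD k j)
    _ = t * (D *ᵥ w) k := by
      simp only [mulVec, dotProduct, Finset.mul_sum]
      exact Finset.sum_congr rfl fun j _ => by ring
    _ ≤ t * (r * w k) := mul_le_mul_of_nonneg_left (h k) ht0.le
    _ = r * ‖z k‖ := by rw [hzk]; ring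
  have h2 : ‖μ‖ ≤ r := le_of_mul_le_mul_right h1 (hzk ▸ mul_pos ht0 (hw k))
  rw [← enorm_eq_nnnorm, ← ofReal_norm]
  exact ENNReal.ofReal_le_ofReal h2

theorem specRad_le [Nonempty κ] {D : Matrix κ κ ℝ} (hD : ∀ i j, 0 ≤ D i j) {w : κ → ℝ}
    (hw : ∀ i, 0 < w i) {r : ℝ} (h : D *ᵥ w ≤ r • w) (hr : 0 ≤ r) : specRad D ≤ r :=
  ENNReal.toReal_le_of_le_ofReal hr (spectralRadius_le hD hw h)

theorem specRad_eq [Nonempty κ] {D : Matrix κ κ ℝ} (hD : ∀ i j, 0 ≤ D i j) {w : κ → ℝ}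
    (hw : ∀ i, 0 < w i) {r : ℝ} (h : D *ᵥ w = r • w) (hr : 0 ≤ r) : specRad D = r := by
  refine le_antisymm (specRad_le hD hw h.le hr) ?_
  have hmem : (r : ℂ) ∈ spectrum ℂ (D.map Complex.ofReal) := by
    rw [← Matrix.spectrum_toLin', ← Module.End.hasEigenvalue_iff_mem_spectrum]
    refine Module.End.hasEigenvalue_of_hasEigenvector (x := fun i => (w i : ℂ))
      ⟨Module.End.mem_eigenspace_iff.2 ?_, ?_⟩
    · ext i
      have := congrArg Complex.ofReal (congrFun h i)
      simpa [mulVec, dotProduct] using this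
    · intro h0
      obtain ⟨i⟩ := ‹Nonempty κ›
      exact (hw i).ne' (by simpa using congrFun h0 i)
  have hfin : spectralRadius ℂ (D.map Complex.ofReal) ≠ ⊤ :=
    ((spectralRadius_le hD hw h.le).trans_lt ENNReal.ofReal_lt_top).ne
  have h1 : (‖(r : ℂ)‖₊ : ENNReal) ≤ spectralRadius ℂ (D.map Complex.ofReal) :=
    le_iSup₂ (f := fun (k : ℂ) (_ : k ∈ spectrum ℂ (D.map Complex.ofReal)) => (‖k‖₊ : ENNReal)) _ hmem
  have h2 := ENNReal.toReal_mono hfin h1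
  simpa [specRad, abs_of_nonneg hr] using h2

theorem pow_mulVec_mulVec (D : Matrix κ κ ℝ) (N : ℕ) (x : κ → ℝ) :
    D ^ N *ᵥ (D *ᵥ x) = D *ᵥ (D ^ N *ᵥ x) := by
  rw [mulVec_mulVec, mulVec_mulVec, ← pow_succ, ← pow_succ']

theorem pow_mulVec_eq {D : Matrix κ κ ℝ} {x : κ → ℝ} {r : ℝ} (h : D *ᵥ x = r • x) (N : ℕ) :
    D ^ N *ᵥ x = r ^ N • x := by
  induction N with
  | zero => simp
  | succ N ih => rw [pow_succ, ← mulVec_mulVec, h, mulVec_smul, ih, smul_smul, pow_succ']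

/-- Perron's theorem for a primitive matrix: a positive eigenvector. -/
theorem exists_pos_eigenvector [Nonempty κ] {D : Matrix κ κ ℝ} (hD : D.IsPrimitive) :
    ∃ r : ℝ, 0 < r ∧ ∃ v : κ → ℝ, (∀ i, 0 < v i) ∧ D *ᵥ v = r • v := by
  obtain ⟨N, hN0, hN⟩ := hD.exists_pos_pow
  let K : Set ((κ → ℝ) × ℝ) :=
    (stdSimplex ℝ κ ×ˢ Set.Icc 0 (∑ i, ∑ j, D i j)) ∩ {p | p.2 • p.1 ≤ D *ᵥ p.1}
  have hmem : ∀ x ∈ stdSimplex ℝ κ, ∀ t : ℝ, 0 ≤ t → t • x ≤ D *ᵥ x → (x, t) ∈ K := by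
    intro x hx t ht h
    refine ⟨⟨hx, ht, ?_⟩, h⟩
    calc t = ∑ i, (t • x) i := by simp [← Finset.mul_sum, hx.2]
      _ ≤ ∑ i, (D *ᵥ x) i := Finset.sum_le_sum fun i _ => h i
      _ ≤ _ := sum_mulVec_le hD.nonneg hx
  have hK : IsCompact K := by
    refine ((isCompact_stdSimplex ℝ κ).prod isCompact_Icc).inter_right (isClosed_le ?_ ?_)
    · fun_prop
    · exact continuous_const.matrix_mulVec continuous_fst
  have hKne : K.Nonempty := by
    obtain ⟨k⟩ := ‹Nonempty κ›
    refine ⟨_, hmem _ (single_mem_stdSimplex ℝ k) 0 le_rfl ?_⟩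
    rw [zero_smul]
    exact fun i => Finset.sum_nonneg fun j _ =>
      mul_nonneg (hD.nonneg i j) ((single_mem_stdSimplex ℝ k).1 j)
  obtain ⟨⟨x, r⟩, hxK, hmax⟩ := hK.exists_isMaxOn hKne continuous_snd.continuousOn
  obtain ⟨⟨hx, hr, -⟩, hle⟩ := hxK
  change 0 ≤ r at hr
  change r • x ≤ D *ᵥ x at hle
  have hx0 : x ≠ 0 := by
    rintro rfl
    simpa using hx.2
  have hy := mulVec_pos hN hx.1 hx0
  set y := D ^ N *ᵥ x with hydef
  have heq : D *ᵥ x = r • x := by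
    by_contra hne
    have hz := mulVec_pos hN (sub_nonneg.2 hle) (sub_ne_zero.2 hne)
    rw [mulVec_sub, mulVec_smul, pow_mulVec_mulVec, ← hydef] at hz
    obtain ⟨ε, hε, h⟩ := exists_pos_smul_le hz hy
    have hs : 0 < ∑ i, y i := Finset.sum_pos (fun i _ => hy i) Finset.univ_nonempty
    have hK' : ((∑ i, y i)⁻¹ • y, r + ε) ∈ K := by
      refine hmem _ ⟨fun i => ?_, ?_⟩ _ (by positivity) ?_
      · exact mul_nonneg (inv_nonneg.2 hs.le) (hy i).le
      · simp [← Finset.mul_sum, inv_mul_cancel₀ hs.ne']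
      · rw [mulVec_smul, smul_comm]
        refine smul_le_smul_of_nonneg_left (fun i => ?_) (inv_nonneg.2 hs.le)
        have := h i
        simp only [Pi.sub_apply, Pi.smul_apply, smul_eq_mul] at this ⊢
        linarith
    have : r + ε ≤ r := hmax hK'
    linarith
  rw [pow_mulVec_eq heq] at hydef
  have hpos : ∀ i, 0 < r ^ N * x i := fun i => by simpa [hydef] using hy i
  refine ⟨r, hr.lt_of_ne' ?_, x, fun i => (hx.1 i).lt_of_ne' ?_, heq⟩
  · rintro rfl
    obtain ⟨k⟩ := ‹Nonempty κ›
    simpa [hN0.ne'] using hpos k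
  · intro h
    change x i = 0 at h
    exact (hpos i).ne' (by rw [h, mul_zero])

theorem exists_perron [Nonempty κ] {D : Matrix κ κ ℝ} (hD : D.IsPrimitive) :
    0 < specRad D ∧ ∃ v : κ → ℝ, (∀ i, 0 < v i) ∧ D *ᵥ v = specRad D • v := by
  obtain ⟨r, hr, v, hv, h⟩ := exists_pos_eigenvector hD
  rw [specRad_eq hD.nonneg hv h hr.le]
  exact ⟨hr, v, hv, h⟩

/-- If `D v ≤ r v` for a positive vector `v`, without equality, then the spectral radius of the
primitive matrix `D` is smaller than `r`. -/
theorem specRad_lt [Nonempty κ] {D : Matrix κ κ ℝ} (hD : D.IsPrimitive) {v : κ → ℝ}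
    (hv : ∀ i, 0 < v i) {r : ℝ} (h : D *ᵥ v ≤ r • v) (hne : D *ᵥ v ≠ r • v) : specRad D < r := by
  obtain ⟨N, hN0, hN⟩ := hD.exists_pos_pow
  have hv0 : v ≠ 0 := by
    rintro rfl
    exact (hv (Classical.arbitrary κ)).false
  have hw := mulVec_pos hN (fun i => (hv i).le) hv0
  have hz := mulVec_pos hN (sub_nonneg.2 h) (sub_ne_zero.2 hne.symm)
  rw [mulVec_sub, mulVec_smul, pow_mulVec_mulVec] at hz
  set w := D ^ N *ᵥ v
  obtain ⟨ε, hε, h'⟩ := exists_pos_smul_le hz hw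
  have hle : D *ᵥ w ≤ (r - ε) • w := fun i => by
    have := h' i
    simp only [Pi.sub_apply, Pi.smul_apply, smul_eq_mul] at this ⊢
    linarith
  have hr : 0 ≤ r - ε := by
    obtain ⟨k⟩ := ‹Nonempty κ›
    have h0 : 0 ≤ (D *ᵥ w) k :=
      Finset.sum_nonneg fun j _ => mul_nonneg (hD.nonneg k j) (hw j).le
    exact nonneg_of_mul_nonneg_left (h0.trans (hle k)) (hw k)
  linarith [specRad_le hD.nonneg hw hle hr]

end IteratedGraphSystem

namespace IteratedGraphSystem

open Matrix MarkedGraph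

section contraction

variable {κ : Type v} [Fintype κ]

theorem exists_tight_lower [Nonempty κ] {v : κ → ℝ} (hv : ∀ i, 0 < v i) (y : κ → ℝ) :
    ∃ m : ℝ, m • v ≤ y ∧ ∃ k, y k = m * v k := by
  obtain ⟨k, hk⟩ := Finite.exists_min fun i => y i / v i
  exact ⟨y k / v k, fun i => (le_div_iff₀ (hv i)).1 (hk i), k,
    (div_mul_cancel₀ _ (hv k).ne').symm⟩

theorem exists_tight_upper [Nonempty κ] {v : κ → ℝ} (hv : ∀ i, 0 < v i) (y : κ → ℝ) :
    ∃ m : ℝ, y ≤ m • v ∧ ∃ k, y k = m * v k := by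
  obtain ⟨k, hk⟩ := Finite.exists_max fun i => y i / v i
  exact ⟨y k / v k, fun i => (div_le_iff₀ (hv i)).1 (hk i), k,
    (div_mul_cancel₀ _ (hv k).ne').symm⟩

variable [DecidableEq κ]

theorem le_pow_mulVec {B : Matrix κ κ ℝ} (hB : ∀ i j, 0 ≤ B i j) {y : ℕ → κ → ℝ}
    (hup : ∀ n, y (n + 1) ≤ B *ᵥ y n) (n N : ℕ) : y (n + N) ≤ B ^ N *ᵥ y n := by
  induction N with
  | zero => simp
  | succ N ih =>
    rw [pow_succ', ← mulVec_mulVec]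
    exact (hup (n + N)).trans (mulVec_le_mulVec hB ih)

/-- A sequence of vectors that is bounded above by the iteration of one primitive matrix with
positive fixed vector `v`, and that keeps all lower bounds by multiples of `v`, converges to a
positive multiple of `v`. -/
theorem exists_tendsto_bounds [Nonempty κ] {B : Matrix κ κ ℝ} (hB : B.IsPrimitive) {v : κ → ℝ}
    (hv : ∀ i, 0 < v i) (hBv : B *ᵥ v = v) {y : ℕ → κ → ℝ} (hy : ∀ i, 0 < y 0 i)
    (hup : ∀ n, y (n + 1) ≤ B *ᵥ y n)
    (hlow : ∀ n (m : ℝ), 0 ≤ m → m • v ≤ y n → m • v ≤ y (n + 1)) :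
    ∃ c > 0, ∃ lo hi : ℕ → ℝ, Tendsto lo atTop (𝓝 c) ∧ Tendsto hi atTop (𝓝 c) ∧
      ∀ n, lo n • v ≤ y n ∧ y n ≤ hi n • v := by
  obtain ⟨N, -, hN⟩ := hB.exists_pos_pow
  choose lo hlo klo hklo using fun n => exists_tight_lower hv (y n)
  choose hi hhi khi hkhi using fun n => exists_tight_upper hv (y n)
  have le_lo : ∀ n (m : ℝ), m • v ≤ y n → m ≤ lo n := fun n m h =>
    le_of_mul_le_mul_right (hklo n ▸ h (klo n)) (hv _)
  have hi_le : ∀ n (m : ℝ), y n ≤ m • v → hi n ≤ m := fun n m h =>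
    le_of_mul_le_mul_right (hkhi n ▸ h (khi n)) (hv _)
  have hlohi : ∀ n, lo n ≤ hi n := fun n =>
    le_of_mul_le_mul_right (hklo n ▸ hhi n (klo n)) (hv (klo n))
  have hlo0 : 0 < lo 0 := pos_of_mul_pos_left (hklo 0 ▸ hy (klo 0)) (hv _).le
  have hlo_nonneg : ∀ n, 0 ≤ lo n := fun n => by
    induction n with
    | zero => exact hlo0.le
    | succ n ih => exact ih.trans (le_lo _ _ (hlow n _ ih (hlo n)))
  have hlomono : Monotone lo := monotone_nat_of_le_succ fun n =>
    le_lo _ _ (hlow n _ (hlo_nonneg n) (hlo n))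
  have hhianti : Antitone hi := antitone_nat_of_succ_le fun n => hi_le _ _ <| by
    refine (hup n).trans ((mulVec_le_mulVec hB.nonneg (hhi n)).trans ?_)
    rw [mulVec_smul, hBv]
  have hBN : B ^ N *ᵥ v = v := by
    simpa using pow_mulVec_eq (r := 1) (by simpa using hBv) N
  obtain ⟨δ, hδ, hδ'⟩ := exists_pos_smul_le (κ := κ × κ) (a := fun q => (B ^ N) q.1 q.2 * v q.2)
    (b := fun q => v q.1) (fun q => mul_pos (hN _ _) (hv _)) (fun q => hv _)
  have hcontr : ∀ n, hi (n + N) ≤ hi n - δ * (hi n - lo n) := fun n => hi_le _ _ fun i => by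
    have hz : ∀ j, 0 ≤ hi n * v j - y n j := fun j => sub_nonneg.2 (hhi n j)
    have h1 : (B ^ N) i (klo n) * (hi n * v (klo n) - y n (klo n)) ≤
        ∑ j, (B ^ N) i j * (hi n * v j - y n j) :=
      Finset.single_le_sum (f := fun j => (B ^ N) i j * (hi n * v j - y n j))
        (fun j _ => mul_nonneg (hN i j).le (hz j)) (Finset.mem_univ _)
    have h2 : ∑ j, (B ^ N) i j * (hi n * v j - y n j) = hi n * v i - (B ^ N *ᵥ y n) i := by
      have : B ^ N *ᵥ (hi n • v - y n) = hi n • v - B ^ N *ᵥ y n := by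
        rw [mulVec_sub, mulVec_smul, hBN]
      exact congrFun this i
    have h3 := mul_le_mul_of_nonneg_left (hδ' (i, klo n)) (sub_nonneg.2 (hlohi n))
    have h4 := le_pow_mulVec hB.nonneg hup n N i
    rw [h2, hklo n] at h1
    simp only [Pi.smul_apply, smul_eq_mul] at h3 ⊢
    nlinarith
  have hhilim : Tendsto hi atTop (𝓝 (⨅ n, hi n)) :=
    tendsto_atTop_ciInf hhianti ⟨lo 0, by
      rintro _ ⟨n, rfl⟩
      exact (hlomono (Nat.zero_le n)).trans (hlohi n)⟩
  set c := ⨅ n, hi n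
  have hlolim : Tendsto lo atTop (𝓝 c) := by
    have h1 : Tendsto (fun n => hi n - (hi n - hi (n + N)) / δ) atTop (𝓝 (c - (c - c) / δ)) :=
      hhilim.sub ((hhilim.sub (hhilim.comp (tendsto_add_atTop_nat N))).div_const δ)
    rw [sub_self, zero_div, sub_zero] at h1
    refine tendsto_of_tendsto_of_tendsto_of_le_of_le h1 hhilim (fun n => ?_) hlohi
    have h2 : hi n - lo n ≤ (hi n - hi (n + N)) / δ := by
      rw [le_div_iff₀ hδ]
      linarith [hcontr n]
    change hi n - (hi n - hi (n + N)) / δ ≤ lo n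
    linarith
  exact ⟨c, hlo0.trans_le (hlomono.ge_of_tendsto hlolim 0), lo, hi, hlolim, hhilim,
    fun n => ⟨hlo n, hhi n⟩⟩

theorem isPrimitive_smul {D : Matrix κ κ ℝ} (hD : D.IsPrimitive) {a : ℝ} (ha : 0 < a) :
    (a • D).IsPrimitive := by
  obtain ⟨N, hN0, hN⟩ := hD.exists_pos_pow
  refine ⟨fun i j => mul_nonneg ha.le (hD.nonneg i j), N, hN0, fun i j => ?_⟩
  rw [smul_pow]
  exact mul_pos (pow_pos ha N) (hN i j)

/-- The form of `exists_tendsto_bounds` for a positive eigenvector with eigenvalue `r`. -/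
theorem exists_tendsto_bounds_pow [Nonempty κ] {D : Matrix κ κ ℝ} (hD : D.IsPrimitive) {v : κ → ℝ}
    (hv : ∀ i, 0 < v i) {r : ℝ} (hr : 0 < r) (hDv : D *ᵥ v = r • v) {x : ℕ → κ → ℝ}
    (hx : ∀ i, 0 < x 0 i) (hup : ∀ n, x (n + 1) ≤ D *ᵥ x n)
    (hlow : ∀ n (m : ℝ), 0 ≤ m → m • v ≤ x n → (r * m) • v ≤ x (n + 1)) :
    ∃ c > 0, ∃ lo hi : ℕ → ℝ, Tendsto lo atTop (𝓝 c) ∧ Tendsto hi atTop (𝓝 c) ∧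
      ∀ n, (r ^ n * lo n) • v ≤ x n ∧ x n ≤ (r ^ n * hi n) • v := by
  have hpow : ∀ n, 0 < r ^ n := fun n => pow_pos hr n
  have hle : ∀ n (m : ℝ), m • v ≤ (r ^ n)⁻¹ • x n ↔ (r ^ n * m) • v ≤ x n := fun n m => by
    rw [le_inv_smul_iff_of_pos (hpow n), smul_smul]
  obtain ⟨c, hc, lo, hi, hlo, hhi, h⟩ := exists_tendsto_bounds
    (isPrimitive_smul hD (inv_pos.2 hr)) hv (y := fun n => (r ^ n)⁻¹ • x n)
    (by rw [smul_mulVec, hDv, inv_smul_smul₀ hr.ne']) (by simpa using hx)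
    (fun n => by
      rw [mulVec_smul, smul_mulVec, smul_smul, pow_succ, mul_inv]
      exact smul_le_smul_of_nonneg_left (hup n)
        (mul_nonneg (inv_pos.2 (hpow n)).le (inv_pos.2 hr).le))
    (fun n m hm0 hm => by
      rw [hle] at hm ⊢
      rw [pow_succ', mul_assoc]
      exact hlow n _ (mul_nonneg (hpow n).le hm0) hm)
  refine ⟨c, hc, lo, hi, hlo, hhi, fun n => ⟨(hle n _).1 (h n).1, ?_⟩⟩
  rw [mul_smul, ← inv_smul_le_iff_of_pos (hpow n)]
  exact (h n).2

end contraction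

variable {κ : Type v} [DecidableEq κ] (S : IteratedGraphSystem.{u, v} κ)

theorem pathMatrices_nonempty : S.pathMatrices.Nonempty := by
  choose p hp _ using fun i =>
    ((S.rule_admissible i).connected (S.rule i).A (S.rule i).B).some.exists_isPath
  exact ⟨_, p, hp, rfl⟩

/-- A walk between different nodes has an arc, hence a colour. -/
theorem exists_chi_pos {G : MarkedGraph.{u, v} κ} {x y : G.V} (hxy : x ≠ y) (p : G.Walk x y) :
    ∃ j, 0 < p.chi j := by
  cases p with
  | nil => exact absurd rfl hxy
  | cons e h p => exact ⟨G.col e, by simp [Walk.chi, Walk.arcs]⟩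

theorem updateRow_mem_pathMatrices {D D' : Matrix κ κ ℝ} (hD : D ∈ S.pathMatrices)
    (hD' : D' ∈ S.pathMatrices) (i : κ) : D.updateRow i (D' i) ∈ S.pathMatrices := by
  obtain ⟨P, hP, rfl⟩ := hD
  obtain ⟨Q, hQ, rfl⟩ := hD'
  refine ⟨Function.update P i (Q i), fun k => ?_, ?_⟩
  · by_cases h : k = i
    · subst h
      simpa using hQ k
    · simpa [h] using hP k
  · ext k j
    by_cases h : k = i
    · subst h
      simp
    · simp [h]

variable [Fintype κ]

theorem pathMatrices_finite : S.pathMatrices.Finite := by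
  have := fun i => (S.rule_admissible i).finite_V
  refine ((Set.Finite.pi' fun i =>
    finite_setOf_chi (S.rule i) (S.rule i).A (S.rule i).B).image
      fun c : κ → κ → ℕ => Matrix.of fun i j => (c i j : ℝ)).subset ?_
  rintro _ ⟨P, hP, rfl⟩
  exact ⟨fun i => (P i).chi, fun i => ⟨P i, hP i, rfl⟩, rfl⟩

theorem ruleWeight_le_mulVec {D : Matrix κ κ ℝ} (hD : D ∈ S.pathMatrices) (w : κ → ℕ) :
    (fun i => (ruleWeight S.rule w i : ℝ)) ≤ D *ᵥ fun i => (w i : ℝ) := by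
  obtain ⟨P, hP, rfl⟩ := hD
  intro i
  have h := wdist_le (w := w) (P i)
  rw [Walk.weight_eq_sum_chi] at h
  have h' : ((S.rule i).wdist w (S.rule i).A (S.rule i).B : ℝ) ≤
    ((∑ j, (P i).chi j * w j : ℕ) : ℝ) := Nat.cast_le.2 h
  simpa [mulVec, dotProduct, ruleWeight] using h'

theorem exists_ruleWeight_eq_mulVec (w : κ → ℕ) :
    ∃ D ∈ S.pathMatrices, (fun i => (ruleWeight S.rule w i : ℝ)) = D *ᵥ fun i => (w i : ℝ) := by
  choose P hP h using fun i => exists_isPath_weight_eq_wdist (w := w)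
    ((S.rule_admissible i).connected (S.rule i).A (S.rule i).B)
  refine ⟨_, ⟨P, hP, rfl⟩, ?_⟩
  ext i
  have h' := congrArg (Nat.cast : ℕ → ℝ) (h i)
  rw [Walk.weight_eq_sum_chi] at h'
  simpa [mulVec, dotProduct, ruleWeight] using h'.symm

/-- If `D` has the smallest spectral radius among the path matrices, then its Perron vector is
expanded by every path matrix at least as much as by `D`. -/
theorem smul_le_mulVec_of_minimal [Nonempty κ] (hS : S.IsPrimitive) {D D' : Matrix κ κ ℝ}
    (hD : D ∈ S.pathMatrices) (hD' : D' ∈ S.pathMatrices) {r : ℝ}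
    (hmin : ∀ E ∈ S.pathMatrices, r ≤ specRad E) {v : κ → ℝ} (hv : ∀ i, 0 < v i)
    (hDv : D *ᵥ v = r • v) : r • v ≤ D' *ᵥ v := by
  intro i
  by_contra! hlt
  have hE := S.updateRow_mem_pathMatrices hD hD' i
  have hi : (D.updateRow i (D' i) *ᵥ v) i = (D' *ᵥ v) i := by
    simp [mulVec]
  have hk : ∀ k ≠ i, (D.updateRow i (D' i) *ᵥ v) k = (r • v) k := fun k hk => by
    rw [← hDv]
    simp [mulVec, hk]
  refine (specRad_lt (hS.2 _ hE) hv (fun k => ?_) fun h => ?_).not_ge (hmin _ hE)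
  · by_cases h : k = i
    · subst h
      exact hi.trans_le hlt.le
    · exact (hk k h).le
  · exact (hi.symm.trans (congrFun h i)).not_lt hlt

theorem isLeast_rhoMin : IsLeast (specRad '' S.pathMatrices) S.rhoMin :=
  have hfin := S.pathMatrices_finite.image specRad
  ⟨(S.pathMatrices_nonempty.image _).csInf_mem hfin, fun _ h => csInf_le hfin.bddBelow h⟩

theorem exists_minimal_path (v : κ → ℝ) :
    ∃ p : S.init.Walk S.init.A S.init.B, ∀ q : S.init.Walk S.init.A S.init.B, q.IsPath →
      ∑ j, p.chi j * v j ≤ ∑ j, q.chi j * v j := by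
  have := S.init_admissible.finite_V
  obtain ⟨p, hp, -⟩ := (S.init_admissible.connected S.init.A S.init.B).some.exists_isPath
  obtain ⟨_, ⟨p, hp, rfl⟩, h⟩ := Set.exists_min_image _ (fun c : κ → ℕ => ∑ j, c j * v j)
    (finite_setOf_chi S.init S.init.A S.init.B) ⟨_, p, hp, rfl⟩
  exact ⟨p, fun q hq => h _ ⟨q, hq, rfl⟩⟩

/-- The weighted distances in the initial graph grow like the weights. -/
theorem exists_tendsto_wdist {w : ℕ → κ → ℕ} {v : κ → ℝ} (hv : ∀ i, 0 < v i) {r c : ℝ}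
    (hr : 0 < r) (hc : 0 < c) {lo hi : ℕ → ℝ} (hlo : Tendsto lo atTop (𝓝 c))
    (hhi : Tendsto hi atTop (𝓝 c)) (hw : ∀ n, (r ^ n * lo n) • v ≤ (fun i => (w n i : ℝ)) ∧
      (fun i => (w n i : ℝ)) ≤ (r ^ n * hi n) • v) :
    ∃ c' > 0, Tendsto (fun n => (S.init.wdist (w n) S.init.A S.init.B : ℝ) / r ^ n) atTop
      (𝓝 c') := by
  obtain ⟨p, hp⟩ := S.exists_minimal_path v
  obtain ⟨k, hk⟩ := exists_chi_pos S.init_admissible.A_ne_B p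
  have ha : 0 < ∑ j, p.chi j * v j :=
    Finset.sum_pos' (fun j _ => mul_nonneg (Nat.cast_nonneg _) (hv j).le)
      ⟨k, Finset.mem_univ k, mul_pos (Nat.cast_pos.2 hk) (hv k)⟩
  set a := ∑ j, p.chi j * v j with hadef
  refine ⟨c * a, mul_pos hc ha, tendsto_of_tendsto_of_tendsto_of_le_of_le'
    (hlo.mul_const a) (hhi.mul_const a) ?_ (Eventually.of_forall fun n => ?_)⟩
  · filter_upwards [hlo.eventually (lt_mem_nhds hc)] with n hn
    obtain ⟨q, hq, hqw⟩ := exists_isPath_weight_eq_wdist (w := w n)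
      (S.init_admissible.connected S.init.A S.init.B)
    rw [le_div_iff₀ (pow_pos hr n), ← hqw, Walk.weight_eq_sum_chi]
    push_cast
    calc lo n * a * r ^ n ≤ lo n * (∑ j, q.chi j * v j) * r ^ n := by
          gcongr
          exact hp q hq
      _ = ∑ j, q.chi j * (r ^ n * lo n * v j) := by
          rw [Finset.mul_sum, Finset.sum_mul]
          exact Finset.sum_congr rfl fun j _ => by ring
      _ ≤ _ := Finset.sum_le_sum fun j _ =>
          mul_le_mul_of_nonneg_left ((hw n).1 j) (Nat.cast_nonneg _)
  · rw [div_le_iff₀ (pow_pos hr n)]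
    calc (S.init.wdist (w n) S.init.A S.init.B : ℝ) ≤ ((∑ j, p.chi j * w n j : ℕ) : ℝ) := by
          rw [← Walk.weight_eq_sum_chi]
          exact Nat.cast_le.2 (wdist_le p)
      _ = ∑ j, (p.chi j : ℝ) * w n j := by push_cast; rfl
      _ ≤ ∑ j, p.chi j * (r ^ n * hi n * v j) := Finset.sum_le_sum fun j _ =>
          mul_le_mul_of_nonneg_left ((hw n).2 j) (Nat.cast_nonneg _)
      _ = hi n * a * r ^ n := by
          rw [hadef, Finset.mul_sum, Finset.sum_mul]
          exact Finset.sum_congr rfl fun j _ => by ring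

theorem exists_tendsto_length (hS : S.IsPrimitive) :
    ∃ c : ℝ, 0 < c ∧
      ∀ Γ : ∀ n, (S.Xi n).Walk (S.Xi n).A (S.Xi n).B, (∀ n, (Γ n).IsShortestPath) →
        Tendsto (fun n => ((Γ n).length : ℝ) / S.rhoMin ^ n) atTop (𝓝 c) := by
  obtain ⟨p⟩ := S.init_admissible.connected S.init.A S.init.B
  have : Nonempty κ := ⟨(exists_chi_pos S.init_admissible.A_ne_B p).choose⟩
  obtain ⟨⟨D, hD, hDr⟩, hmin⟩ := S.isLeast_rhoMin
  obtain ⟨hr, v, hv, hDv⟩ := exists_perron (hS.2 D hD)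
  rw [hDr] at hr hDv
  have hmin' : ∀ E ∈ S.pathMatrices, S.rhoMin ≤ specRad E := fun E hE => hmin ⟨E, hE, rfl⟩
  set w : ℕ → κ → ℕ := fun n => (ruleWeight S.rule)^[n] fun _ => 1 with hwdef
  have hw : ∀ n, w (n + 1) = ruleWeight S.rule (w n) := fun n =>
    Function.iterate_succ_apply' _ _ _
  obtain ⟨c, hc, lo, hi, hlo, hhi, h⟩ := exists_tendsto_bounds_pow (hS.2 D hD) hv hr hDv
    (x := fun n i => (w n i : ℝ)) (fun i => by simp [hwdef])
    (fun n => by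
      simp only [hw]
      exact S.ruleWeight_le_mulVec hD (w n))
    (fun n m hm0 hm => by
      obtain ⟨E, hE, hEw⟩ := S.exists_ruleWeight_eq_mulVec (w n)
      simp only [hw]
      rw [hEw, mul_comm, mul_smul]
      refine (smul_le_smul_of_nonneg_left
        (S.smul_le_mulVec_of_minimal hS hD hE hmin' hv hDv) hm0).trans ?_
      rw [← mulVec_smul]
      exact mulVec_le_mulVec (hS.2 E hE).nonneg hm)
  obtain ⟨c', hc', hlim⟩ := S.exists_tendsto_wdist hv hr hc hlo hhi h
  exact ⟨c', hc', fun Γ hΓ => by simpa only [S.length_eq_wdist (hΓ _)] using hlim⟩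

end IteratedGraphSystem

theorem mainTheorem4 {κ : Type v} [Fintype κ] [DecidableEq κ]
    (S : IteratedGraphSystem.{u, v} κ) (hS : S.IsPrimitive) :
    IsLeast (IteratedGraphSystem.specRad '' S.pathMatrices) S.rhoMin ∧
    (∀ n, ∃ Γ : (S.Xi n).Walk (S.Xi n).A (S.Xi n).B, Γ.IsShortestPath) ∧
    ∃ c : ℝ, 0 < c ∧
      ∀ Γ : ∀ n, (S.Xi n).Walk (S.Xi n).A (S.Xi n).B, (∀ n, (Γ n).IsShortestPath) →
        Tendsto (fun n => ((Γ n).length : ℝ) / S.rhoMin ^ n) atTop (𝓝 c) :=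
  ⟨S.isLeast_rhoMin, S.exists_isShortestPath, S.exists_tendsto_length hS⟩
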